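/- Let $E$ be a finite set and let $X_t$ be an irreducible continuous-time Markov chain on $E$ with jump rates $r(x,y)\ge 0$, $x\neq y$ (set $r(x,x)=0$), and holding rates $\lambda(x)=\sum_{y} r(x,y)$. Denote by $\mathbb P_x$ its law when it starts from $x$. Let $\mu$ be a stationary measure (non-negative, not identically zero, with arbitrary normalization). For $A\subset E$ let $$T_A^+=\inf\{t>0:\ X_t\in A,\ X_s\neq X_0\text{ for some }0<s<t\},\qquad \inf\varnothing=\infty,$$ and for disjoint $A,B\subset E$ define the capacity $$\mathrm{Cap}(A,B)=\sum_{x\in A}\mu(x)\lambda(x)\,\mathbb P_x[T_A^+>T_B^+].$$ Let $c(x,y)=\mu(x)r(x,y)$, $c^*(x,y)=\mu(x)r^*(x,y)$, where $r^*(x,y)=\mu(y)r(y,x)/\mu(x)$ are the jump rates of the time-reversed chain, $c_s=\tfrac12(c+c^*)$, and $\mathcal E=\{(x,y)\in E\times E: c_s(x,y)>0\}$. A flow is an anti-symmetric function $\varphi:\mathcal E\to\mathbb R$. Its divergence is $(\mathrm{div}\,\varphi)(x)=\sum_{y:(x,y)\in\mathcal E}\varphi(x,y)$, and its norm is given by $$\|\varphi\|^2=\frac12\sum_{(x,y)\in\mathcal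 E}\frac{\varphi(x,y)^2}{c_s(x,y)}.$$ For $f:E\to\mathbb R$ let $\Phi_f$ be the flow $\Phi_f(x,y)=f(x)c(x,y)-f(y)c(y,x)$. Theorem. For any disjoint non-empty sets $A,B\subset E$, $$\mathrm{Cap}(A,B)=\inf_f\,\inf_\varphi\,\|\Phi_f-\varphi\|^2,$$ where the first infimum is over all functions $f:E\to\mathbb R$ equal to $1$ on $A$ and to $0$ on $B$, and the second one is over all flows $\varphi$ such that $$(\mathrm{div}\,\varphi)(x)=0\ \text{ for } x\in (A\cup B)^c,\qquad \sum_{a\in A}(\mathrm{div}\,\varphi)(a)=0,\qquad \sum_{b\in B}(\mathrm{div}\,\varphi)(b)=0.$$ -/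

import Mathlib

open MeasureTheory ProbabilityTheory
open scoped ENNReal NNReal

noncomputable section

/-- The jump rates `r(x,y)`, `x ≠ y`, of a continuous-time Markov chain with state space `E`;
there are no jumps from a state to itself, so the diagonal is set to zero. -/
structure JumpRates (E : Type*) where
  rate : E → E → ℝ
  rate_nonneg : ∀ x y, 0 ≤ rate x y
  rate_self : ∀ x, rate x x = 0

namespace JumpRates

section Chain

variable {E : Type*} (R : JumpRates E)

/-- Every state can be reached from every other one through jumps of positive rate. -/
def IsIrreducible : Prop :=
  ∀ x y, Relation.ReflTransGen (fun u v => 0 < R.rate u v) x y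

variable [Fintype E]

/-- The holding rate `λ(x) = ∑_{y ≠ x} r(x,y)`. -/
def holdRate (x : E) : ℝ := ∑ y, R.rate x y

/-- The generator `(L f)(x) = ∑_y r(x,y) [f(y) - f(x)]`. -/
def generator (f : E → ℝ) (x : E) : ℝ := ∑ y, R.rate x y * (f y - f x)

/-- `μ` is a stationary measure: non-negative, non-zero, and `∑_x μ(x) (L f)(x) = 0` for all `f`.
The normalization of `μ` is arbitrary. -/
def IsStationary (μ : E → ℝ) : Prop :=
  (∀ x, 0 ≤ μ x) ∧ (∃ x, 0 < μ x) ∧ ∀ f : E → ℝ, ∑ x, μ x * R.generator f x = 0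

open Classical in
/-- The jump probabilities `p(x,y) = r(x,y) / λ(x)`. A state with `λ(x) = 0` is absorbing. -/
def jumpProb (x y : E) : ℝ :=
  if R.holdRate x = 0 then (if y = x then 1 else 0) else R.rate x y / R.holdRate x

lemma holdRate_nonneg (x : E) : 0 ≤ R.holdRate x :=
  Finset.sum_nonneg fun y _ => R.rate_nonneg x y

lemma jumpProb_nonneg (x y : E) : 0 ≤ R.jumpProb x y := by
  unfold jumpProb
  split_ifs
  · exact zero_le_one
  · exact le_rfl
  · exact div_nonneg (R.rate_nonneg x y) (R.holdRate_nonneg x)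

lemma sum_jumpProb (x : E) : ∑ y, R.jumpProb x y = 1 := by
  classical
  unfold jumpProb
  by_cases h : R.holdRate x = 0
  · simp only [h, if_true]
    rw [Finset.sum_eq_single x (fun y _ hy => if_neg hy) (by simp), if_pos rfl]
  · simp only [h, if_false]
    rw [← Finset.sum_div]
    exact div_self h

variable [MeasurableSpace E] [DiscreteMeasurableSpace E]

/-- The transition kernel `x ↦ p(x,·)` of the jump chain. -/
def jumpKernel : Kernel E E :=
  Kernel.ofFunOfCountable fun x => ∑ y, ENNReal.ofReal (R.jumpProb x y) • Measure.dirac y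

instance : IsMarkovKernel R.jumpKernel := by
  refine ⟨fun x => ⟨?_⟩⟩
  change (∑ y, ENNReal.ofReal (R.jumpProb x y) • Measure.dirac y : Measure E) Set.univ = 1
  simp only [Measure.coe_finsetSum, Finset.sum_apply, Measure.smul_apply, measure_univ,
    smul_eq_mul, mul_one]
  rw [← ENNReal.ofReal_sum_of_nonneg fun y _ => R.jumpProb_nonneg x y, R.sum_jumpProb,
    ENNReal.ofReal_one]

/-- The law on `E^ℕ` of the discrete-time Markov chain started at `x`, with transition
probabilities `p`. -/
def jumpChainLaw (x : E) : Measure (ℕ → E) :=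
  Kernel.trajMeasure (X := fun _ => E) (Measure.dirac x)
    (fun n => R.jumpKernel.comap (fun h : (Π _ : Finset.Iic n, E) => h ⟨n, by simp⟩)
      (measurable_pi_apply _))

/-- The probability measure `ℙ_x` under which the continuous-time chain starts at `x`: the first
component is the jump chain `Y` started at `x`, the second one an independent sequence `T` of
i.i.d. exponential variables of parameter one. -/
def pathLaw (x : E) : Measure ((ℕ → E) × (ℕ → ℝ)) :=
  (R.jumpChainLaw x).prod (Measure.infinitePi fun _ : ℕ => expMeasure 1)

end Chain

section ContinuousTime

variable {E : Type*} [Fintype E] (R : JumpRates E)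

/-- The time `S_n = ∑_{i < n} T_i / λ(Y_i)` of the `n`-th jump: the time spent in `Y_i` is
exponential of parameter `λ(Y_i)` (and infinite if `λ(Y_i) = 0`). -/
def jumpTime (n : ℕ) (ω : (ℕ → E) × (ℕ → ℝ)) : ℝ≥0∞ :=
  ∑ i ∈ Finset.range n, ENNReal.ofReal (ω.2 i) / ENNReal.ofReal (R.holdRate (ω.1 i))

open Classical in
/-- The continuous-time Markov chain: `X_t = Y_n` for `S_n ≤ t < S_{n+1}`. (On the null event that
the jump times accumulate before `t`, the value is irrelevant and is set to `Y_0`.) -/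
def process (t : ℝ≥0) (ω : (ℕ → E) × (ℕ → ℝ)) : E :=
  if h : ∃ n, (t : ℝ≥0∞) < R.jumpTime (n + 1) ω then ω.1 (Nat.find h) else ω.1 0

/-- The return time `T⁺_A = inf {t > 0 : X_t ∈ A, X_s ≠ X_0 for some 0 < s < t}`, with
`inf ∅ = ∞`. -/
def returnTime (A : Finset E) (ω : (ℕ → E) × (ℕ → ℝ)) : ℝ≥0∞ :=
  sInf {τ : ℝ≥0∞ | ∃ t : ℝ≥0, τ = t ∧ 0 < t ∧ R.process t ω ∈ A ∧
    ∃ s : ℝ≥0, 0 < s ∧ s < t ∧ R.process s ω ≠ R.process 0 ω}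

/-- The capacity `Cap(A,B) = ∑_{x ∈ A} M(x) ℙ_x[T⁺_A > T⁺_B]`, where `M(x) = μ(x) λ(x)`. -/
def capacity [MeasurableSpace E] [DiscreteMeasurableSpace E] (μ : E → ℝ) (A B : Finset E) : ℝ :=
  ∑ x ∈ A, μ x * R.holdRate x * (R.pathLaw x).real {ω | R.returnTime A ω > R.returnTime B ω}

end ContinuousTime

section Flows

variable {E : Type*} (R : JumpRates E) (μ : E → ℝ)

/-- The jump rates of the time-reversed chain, `r*(x,y) = μ(y) r(y,x) / μ(x)`. -/
def adjointRate (x y : E) : ℝ := μ y * R.rate y x / μ x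

/-- The conductances `c(x,y) = μ(x) r(x,y)`. -/
def cond (x y : E) : ℝ := μ x * R.rate x y

/-- The adjoint conductances `c*(x,y) = μ(x) r*(x,y)`. -/
def condAdjoint (x y : E) : ℝ := μ x * R.adjointRate μ x y

/-- The symmetric conductances `c_s = (c + c*) / 2`. -/
def condSymm (x y : E) : ℝ := (R.cond μ x y + R.condAdjoint μ x y) / 2

/-- A flow is an anti-symmetric function on the set `{(x,y) : c_s(x,y) > 0}` of arcs; it is
represented by its extension by zero to `E × E`. -/
def IsFlow (φ : E → E → ℝ) : Prop :=
  (∀ x y, φ y x = -φ x y) ∧ ∀ x y, ¬ 0 < R.condSymm μ x y → φ x y = 0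

/-- The flow `Φ_f(x,y) = f(x) c(x,y) - f(y) c(y,x)`. -/
def flowOf (f : E → ℝ) (x y : E) : ℝ := f x * R.cond μ x y - f y * R.cond μ y x

variable [Fintype E]

open Classical in
/-- The scalar product `⟨φ,ψ⟩ = (1/2) ∑_{(x,y) arc} φ(x,y) ψ(x,y) / c_s(x,y)`. -/
def flowInner (φ ψ : E → E → ℝ) : ℝ :=
  (1 / 2) * ∑ e : E × E with 0 < R.condSymm μ e.1 e.2,
    1 / R.condSymm μ e.1 e.2 * φ e.1 e.2 * ψ e.1 e.2

/-- The norm associated with the scalar product on flows. -/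
def flowNorm (φ : E → E → ℝ) : ℝ := √(R.flowInner μ φ φ)

open Classical in
/-- The divergence `(div φ)(x) = ∑_{y : (x,y) arc} φ(x,y)`. -/
def divergence (φ : E → E → ℝ) (x : E) : ℝ :=
  ∑ y : E with 0 < R.condSymm μ x y, φ x y

/-- The flows over which the inner infimum is taken: divergence free off `A ∪ B`, with zero total
divergence on `A` and on `B`. -/
def IsAdmissibleFlow (A B : Finset E) (φ : E → E → ℝ) : Prop :=
  R.IsFlow μ φ ∧ (∀ x, x ∉ A → x ∉ B → R.divergence μ φ x = 0) ∧
    ∑ a ∈ A, R.divergence μ φ a = 0 ∧ ∑ b ∈ B, R.divergence μ φ b = 0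

end Flows

end JumpRates

end

/-! Write `L` and `L*` for the Laplacians of the conductances `c(x,y)` and `c(y,x)`. Stationarity of
`μ` says that `c` is balanced at each vertex, hence `L` and `L*` are adjoint
(`condLaplacian_adjoint`). Let `V` and `W` be the potentials of `L` and `L*`, and `Ψ_V =
c_s(x,y)[V(x) - V(y)]` the gradient flow.

Summation by parts (`flowInner_gradFlow`) gives `⟨φ, Ψ_V⟩ = ∑ V div φ`. As `div Φ_f = -L* f`, the
product `⟨Φ_f - φ, Ψ_V⟩` equals `-∑_A L V` for every admissible pair `(f, φ)`, and `‖Ψ_V‖²` has the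
same value. Expanding `0 ≤ ‖Φ_f - φ - Ψ_V‖²` yields the lower bound. Equality requires `Φ_f - φ =
Ψ_V`, and for `f = (V + W)/2` the flow `φ = Φ_f - Ψ_V` is admissible.

It remains to see that `-∑_A L V` is the capacity (`capacity_eq`). Almost surely `T⁺_A > T⁺_B` means
that the jump chain, from time one on, meets `B` before `A`. A telescoping sum over the killed chain
shows that this has probability `P(1 - V)(x)`, with `P` the jump operator, and for `x ∈ A` this is
`-L V(x) / (μ(x) λ(x))`. -/

noncomputable section

/-! ### Dirichlet problems for balanced conductances -/

section Conductances

variable {E : Type*} [Fintype E]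

/-- The operator `f ↦ ∑_y c(x,y) [f(y) - f(x)]` attached to conductances `c`. -/
def condLaplacian (c : E → E → ℝ) (f : E → ℝ) (x : E) : ℝ := ∑ y, c x y * (f y - f x)

variable {c : E → E → ℝ}

/-- Exchanging the summation variables matches the off-diagonal terms; balance matches the diagonal
ones. -/
lemma condLaplacian_adjoint (hbal : ∀ x, ∑ y, c x y = ∑ y, c y x) (f g : E → ℝ) :
    ∑ x, g x * condLaplacian c f x = ∑ x, f x * condLaplacian (fun x y => c y x) g x := by
  have h1 : ∀ (c : E → E → ℝ) (f g : E → ℝ), ∑ x, g x * condLaplacian c f x =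
      ∑ x, ∑ y, c x y * g x * f y - ∑ x, g x * f x * ∑ y, c x y := by
    intro c f g
    rw [← Finset.sum_sub_distrib]
    refine Finset.sum_congr rfl fun x _ => ?_
    rw [condLaplacian, Finset.mul_sum, Finset.mul_sum, ← Finset.sum_sub_distrib]
    exact Finset.sum_congr rfl fun y _ => by ring
  rw [h1, h1, Finset.sum_comm]
  congr 1
  · exact Finset.sum_congr rfl fun x _ => Finset.sum_congr rfl fun y _ => by ring
  · exact Finset.sum_congr rfl fun x _ => by rw [hbal, mul_comm (g x)]

/-- Since `2a(b - a) = (b² - a²) - (b - a)²`, it suffices that the differences of squares sum to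
zero, which is balance. -/
lemma sum_mul_condLaplacian_self (hbal : ∀ x, ∑ y, c x y = ∑ y, c y x) (f : E → ℝ) :
    ∑ x, f x * condLaplacian c f x = -(1 / 2) * ∑ x, ∑ y, c x y * (f y - f x) ^ 2 := by
  have h0 : ∑ x, ∑ y, c x y * (f y ^ 2 - f x ^ 2) = 0 := by
    have h1 : ∑ x, ∑ y, c x y * f y ^ 2 = ∑ x, ∑ y, c x y * f x ^ 2 := by
      rw [Finset.sum_comm]
      refine Finset.sum_congr rfl fun x _ => ?_
      rw [← Finset.sum_mul, ← Finset.sum_mul, hbal]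
    simp only [mul_sub, Finset.sum_sub_distrib, h1, sub_self]
  have h2 : ∑ x, f x * condLaplacian c f x + (1 / 2) * ∑ x, ∑ y, c x y * (f y - f x) ^ 2 =
      (1 / 2) * ∑ x, ∑ y, c x y * (f y ^ 2 - f x ^ 2) := by
    simp only [condLaplacian, Finset.mul_sum]
    rw [← Finset.sum_add_distrib]
    refine Finset.sum_congr rfl fun x _ => ?_
    rw [← Finset.sum_add_distrib]
    exact Finset.sum_congr rfl fun y _ => by ring
  linarith

/-- The energy vanishes, so `f` is constant along arcs of positive conductance, hence constant by
irreducibility. -/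
lemma eq_zero_of_condLaplacian_eq_zero (hc : ∀ x y, 0 ≤ c x y)
    (hbal : ∀ x, ∑ y, c x y = ∑ y, c y x)
    (hirr : ∀ x y, Relation.ReflTransGen (fun u v => 0 < c u v) x y)
    {S : Set E} (hS : S.Nonempty) {f : E → ℝ} (hf : ∀ x ∈ S, f x = 0)
    (hf' : ∀ x ∉ S, condLaplacian c f x = 0) : f = 0 := by
  have h0 : ∑ x, f x * condLaplacian c f x = 0 := by
    refine Finset.sum_eq_zero fun x _ => ?_
    by_cases hx : x ∈ S
    · rw [hf x hx, zero_mul]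
    · rw [hf' x hx, mul_zero]
  have h1 : ∑ x, ∑ y, c x y * (f y - f x) ^ 2 = 0 := by
    have := sum_mul_condLaplacian_self hbal f
    linarith
  have hn : ∀ x y, 0 ≤ c x y * (f y - f x) ^ 2 := fun x y => mul_nonneg (hc x y) (sq_nonneg _)
  have h2 : ∀ x y, 0 < c x y → f y = f x := by
    intro x y hxy
    have h3 := (Finset.sum_eq_zero_iff_of_nonneg
      fun x _ => Finset.sum_nonneg fun y _ => hn x y).1 h1 x (Finset.mem_univ x)
    have h4 := (Finset.sum_eq_zero_iff_of_nonneg fun y _ => hn x y).1 h3 y (Finset.mem_univ y)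
    rcases mul_eq_zero.1 h4 with h | h
    · exact absurd h hxy.ne'
    · exact sub_eq_zero.1 (pow_eq_zero_iff two_ne_zero |>.1 h)
  have h5 : ∀ x y, f x = f y := by
    intro x y
    induction hirr x y with
    | refl => rfl
    | tail _ h ih => rw [ih, h2 _ _ h]
  obtain ⟨s, hs⟩ := hS
  funext x
  have h3 : f x = f s := h5 x s
  rw [h3, hf s hs, Pi.zero_apply]

open Classical in
/-- Solvability of the Dirichlet problem with boundary `S`. -/
lemma exists_dirichlet_solution (hc : ∀ x y, 0 ≤ c x y)
    (hbal : ∀ x, ∑ y, c x y = ∑ y, c y x)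
    (hirr : ∀ x y, Relation.ReflTransGen (fun u v => 0 < c u v) x y)
    {S : Set E} (hS : S.Nonempty) (ψ : E → ℝ) :
    ∃ h : E → ℝ, (∀ x ∈ S, h x = ψ x) ∧ ∀ x ∉ S, condLaplacian c h x = ψ x := by
  -- The boundary value problem is a square linear system, so uniqueness implies existence.
  let T : (E → ℝ) →ₗ[ℝ] (E → ℝ) :=
    { toFun := fun f x => if x ∈ S then f x else condLaplacian c f x
      map_add' := by
        intro f g
        funext x
        simp only [Pi.add_apply]
        split_ifs
        · rfl
        · simp only [condLaplacian, Pi.add_apply]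
          rw [← Finset.sum_add_distrib]
          exact Finset.sum_congr rfl fun y _ => by ring
      map_smul' := by
        intro a f
        funext x
        simp only [Pi.smul_apply, smul_eq_mul, RingHom.id_apply]
        split_ifs
        · rfl
        · simp only [condLaplacian, Pi.smul_apply, smul_eq_mul]
          rw [Finset.mul_sum]
          exact Finset.sum_congr rfl fun y _ => by ring }
  have hT : ∀ f x, T f x = if x ∈ S then f x else condLaplacian c f x := fun _ _ => rfl
  have hinj : Function.Injective T := by
    rw [← LinearMap.ker_eq_bot, LinearMap.ker_eq_bot']
    intro f hf
    refine eq_zero_of_condLaplacian_eq_zero hc hbal hirr hS (fun x hx => ?_) fun x hx => ?_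
    · have := congrFun hf x
      rwa [hT, if_pos hx] at this
    · have := congrFun hf x
      rwa [hT, if_neg hx] at this
  obtain ⟨h, hh⟩ := LinearMap.injective_iff_surjective.1 hinj ψ
  refine ⟨h, fun x hx => ?_, fun x hx => ?_⟩
  · rw [← hh, hT, if_pos hx]
  · rw [← hh, hT, if_neg hx]

end Conductances

/-! ### Stationarity and irreducibility in terms of conductances -/

namespace JumpRates

lemma cond_nonneg {E : Type*} {R : JumpRates E} {μ : E → ℝ} (hμ : ∀ x, 0 ≤ μ x) (x y : E) :
    0 ≤ R.cond μ x y :=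
  mul_nonneg (hμ x) (R.rate_nonneg x y)

lemma condSymm_eq {E : Type*} {R : JumpRates E} {μ : E → ℝ} (hpos : ∀ x, 0 < μ x) (x y : E) :
    R.condSymm μ x y = (R.cond μ x y + R.cond μ y x) / 2 := by
  rw [condSymm, condAdjoint, adjointRate, mul_div_cancel₀ _ (hpos x).ne']
  rfl

section Stationary

variable {E : Type*} [Fintype E] {R : JumpRates E} {μ : E → ℝ}

lemma IsStationary.sum_cond (hμ : R.IsStationary μ) (x : E) :
    ∑ y, R.cond μ x y = ∑ y, R.cond μ y x := by
  classical
  have h := hμ.2.2 (Pi.single x 1)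
  have h1 : ∀ z, μ z * R.generator (Pi.single x 1) z =
      R.cond μ z x - Pi.single (M := fun _ => ℝ) x 1 z * ∑ y, R.cond μ z y := by
    intro z
    simp only [generator, mul_sub, Finset.sum_sub_distrib, cond]
    rw [← Finset.mul_sum, ← Finset.sum_mul]
    have : ∑ y, R.rate z y * Pi.single (M := fun _ => ℝ) x 1 y = R.rate z x := by
      simp [Pi.single_apply]
    rw [this]
    ring
  simp only [h1, Finset.sum_sub_distrib] at h
  have h2 : ∑ z, Pi.single (M := fun _ => ℝ) x 1 z * ∑ y, R.cond μ z y = ∑ y, R.cond μ x y := by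
    simp [Pi.single_apply]
  linarith

/-- Positivity spreads along jumps: a state of mass zero has no outflow, hence no inflow. -/
lemma IsStationary.pos (hμ : R.IsStationary μ) (hR : R.IsIrreducible) (x : E) : 0 < μ x := by
  obtain ⟨z, hz⟩ := hμ.2.1
  induction hR z x with
  | refl => exact hz
  | @tail u v _ huv ih =>
    refine lt_of_le_of_ne (hμ.1 v) fun h => ?_
    have h1 := hμ.sum_cond v
    simp only [cond, ← h, zero_mul, Finset.sum_const_zero] at h1
    have h2 := (Finset.sum_eq_zero_iff_of_nonneg
      fun y _ => mul_nonneg (hμ.1 y) (R.rate_nonneg y v)).1 h1.symm u (Finset.mem_univ u)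
    exact (mul_pos ih huv).ne' h2

lemma irreducible_cond (hμ : R.IsStationary μ) (hR : R.IsIrreducible) (x y : E) :
    Relation.ReflTransGen (fun u v => 0 < R.cond μ u v) x y :=
  Relation.ReflTransGen.mono (fun u _ h => mul_pos (hμ.pos hR u) h) x y (hR x y)

lemma irreducible_cond_swap (hμ : R.IsStationary μ) (hR : R.IsIrreducible) (x y : E) :
    Relation.ReflTransGen (fun u v => 0 < R.cond μ v u) x y :=
  Relation.reflTransGen_swap.2 (irreducible_cond hμ hR y x)

lemma condLaplacian_cond (f : E → ℝ) (x : E) :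
    condLaplacian (R.cond μ) f x = μ x * R.generator f x := by
  rw [condLaplacian, generator, Finset.mul_sum]
  exact Finset.sum_congr rfl fun y _ => by rw [cond, mul_assoc]

lemma holdRate_pos (hR : R.IsIrreducible) {x y : E} (hxy : x ≠ y) : 0 < R.holdRate x := by
  rcases Relation.ReflTransGen.cases_head (hR x y) with h | ⟨z, hz, -⟩
  · exact absurd h hxy
  · exact Finset.sum_pos' (fun y _ => R.rate_nonneg x y) ⟨z, Finset.mem_univ z, hz⟩

end Stationary

end JumpRates

/-! ### Hitting probabilities of the jump chain -/

section Partition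

lemma measureReal_eq_sum_fiber {Ω E : Type*} [Fintype E] [MeasurableSpace Ω] [MeasurableSpace E]
    [MeasurableSingletonClass E] (P : Measure Ω) [IsFiniteMeasure P] {Y : Ω → E}
    (hY : Measurable Y) (s : Set Ω) :
    P.real s = ∑ z, P.real {ω | ω ∈ s ∧ Y ω = z} := by
  have h := sum_measureReal_preimage_singleton (μ := P.restrict s) (Finset.univ : Finset E)
    (f := Y) fun y _ => hY (measurableSet_singleton y)
  rw [Finset.coe_univ, Set.preimage_univ, measureReal_restrict_apply_univ] at h
  rw [← h]
  refine Finset.sum_congr rfl fun z _ => ?_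
  rw [measureReal_restrict_apply (hY (measurableSet_singleton z))]
  congr 1
  ext ω
  simp [and_comm]

end Partition

namespace JumpRates

section JumpChain

variable {E : Type*} [Fintype E] [MeasurableSpace E] [DiscreteMeasurableSpace E]
  (R : JumpRates E)

instance (x : E) : IsProbabilityMeasure (R.jumpChainLaw x) := by
  unfold jumpChainLaw
  infer_instance

lemma jumpKernel_singleton (z y : E) :
    R.jumpKernel z {y} = ENNReal.ofReal (R.jumpProb z y) := by
  classical
  change (∑ w, ENNReal.ofReal (R.jumpProb z w) • Measure.dirac w : Measure E) {y} = _
  simp [Measure.coe_finsetSum, Set.indicator_apply]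

lemma jumpChainLaw_zero (x : E) : (R.jumpChainLaw x).map (fun ω => ω 0) = Measure.dirac x := by
  have h1 : ∀ κ : (n : ℕ) → Kernel (Π _ : Finset.Iic n, E) E, ∀ [∀ n, IsMarkovKernel (κ n)],
      Kernel.trajMeasure (X := fun _ => E) (Measure.dirac x) κ =
        Kernel.traj (X := fun _ => E) κ 0 (fun _ => x) := by
    intro κ _
    rw [Kernel.trajMeasure, Measure.map_dirac' (by fun_prop), Measure.dirac_bind (by fun_prop)]
    rfl
  rw [jumpChainLaw, h1]
  have h2 : (fun ω : ℕ → E => ω 0) =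
      (fun u : Π _ : Finset.Iic 0, E => u ⟨0, by simp⟩) ∘
        Preorder.frestrictLe (π := fun _ => E) 0 := rfl
  rw [h2, ← Measure.map_map (by fun_prop) (by fun_prop), Kernel.traj_map_frestrictLe_apply,
    Kernel.partialTraj_self, Kernel.id_apply, Measure.map_dirac' (by fun_prop)]

/-- The Markov property of the jump chain. -/
lemma jumpChainLaw_step (x : E) (k : ℕ) (S : Set (Π _ : Finset.Iic k, E)) (z y : E) :
    (R.jumpChainLaw x).real
        {ω | Preorder.frestrictLe (π := fun _ => E) k ω ∈ S ∧ ω k = z ∧ ω (k + 1) = y} =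
      (R.jumpChainLaw x).real
        {ω | Preorder.frestrictLe (π := fun _ => E) k ω ∈ S ∧ ω k = z} * R.jumpProb z y := by
  let κ : (n : ℕ) → Kernel (Π _ : Finset.Iic n, E) E := fun n =>
    R.jumpKernel.comap (fun h : (Π _ : Finset.Iic n, E) => h ⟨n, by simp⟩)
      (measurable_pi_apply _)
  -- The history up to `k` and the next state have the composition-product as joint law; on `T` the
  -- kernel depends only on `z`.
  have hm := Kernel.map_frestrictLe_trajMeasure_compProd_eq_map_trajMeasure
    (X := fun _ => E) (μ₀ := Measure.dirac x) (κ := κ) (a := k)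
  change (R.jumpChainLaw x).map _ ⊗ₘ κ k = (R.jumpChainLaw x).map _ at hm
  set T : Set (Π _ : Finset.Iic k, E) := {u | u ∈ S ∧ u ⟨k, by simp⟩ = z} with hT
  have hTm : MeasurableSet T := MeasurableSet.of_discrete
  have hp := congrArg (fun ν => ν (T ×ˢ {y})) hm
  beta_reduce at hp
  rw [Measure.compProd_apply_prod hTm (measurableSet_singleton y),
    Measure.map_apply (by fun_prop) (hTm.prod (measurableSet_singleton y))] at hp
  have hc : ∫⁻ u in T, κ k u {y} ∂((R.jumpChainLaw x).map (Preorder.frestrictLe k)) =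
      ∫⁻ _ in T, ENNReal.ofReal (R.jumpProb z y)
        ∂((R.jumpChainLaw x).map (Preorder.frestrictLe k)) := by
    refine setLIntegral_congr_fun hTm fun u hu => ?_
    change R.jumpKernel (u ⟨k, _⟩) {y} = _
    rw [hu.2, jumpKernel_singleton]
  rw [hc, setLIntegral_const, Measure.map_apply (by fun_prop) hTm] at hp
  have h1 : {ω : ℕ → E | Preorder.frestrictLe (π := fun _ => E) k ω ∈ S ∧ ω k = z ∧
      ω (k + 1) = y} = (fun ω => (Preorder.frestrictLe (π := fun _ => E) k ω, ω (k + 1))) ⁻¹'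
        (T ×ˢ {y}) := by
    ext ω
    simp [hT, and_assoc]
  have h2 : {ω : ℕ → E | Preorder.frestrictLe (π := fun _ => E) k ω ∈ S ∧ ω k = z} =
      Preorder.frestrictLe (π := fun _ => E) k ⁻¹' T := rfl
  rw [h1, h2, measureReal_def, ← hp, ENNReal.toReal_mul,
    ENNReal.toReal_ofReal (R.jumpProb_nonneg z y), mul_comm]
  rfl

/-- The probability that the jump chain avoids `C` at times `1, …, k` and is in `z` at time `k`. -/
def avoidProb (x : E) (C : Set E) (k : ℕ) (z : E) : ℝ :=
  (R.jumpChainLaw x).real {ω | (∀ m ∈ Finset.Icc 1 k, ω m ∉ C) ∧ ω k = z}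

lemma avoidProb_nonneg (x : E) (C : Set E) (k : ℕ) (z : E) : 0 ≤ R.avoidProb x C k z :=
  measureReal_nonneg

lemma sum_avoidProb_le (x : E) (C : Set E) (k : ℕ) : ∑ z, R.avoidProb x C k z ≤ 1 := by
  have h := measureReal_eq_sum_fiber (R.jumpChainLaw x) (Y := fun ω => ω k) (by fun_prop)
    {ω | ∀ m ∈ Finset.Icc 1 k, ω m ∉ C}
  exact h.symm.trans_le measureReal_le_one

/-- Nothing is to be avoided at time zero, so the mass sits at `x` even when `x ∈ C`. -/
lemma avoidProb_zero (x : E) (C : Set E) (f : E → ℝ) : ∑ z, R.avoidProb x C 0 z * f z = f x := by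
  classical
  have h : ∀ z, R.avoidProb x C 0 z = if z = x then 1 else 0 := by
    intro z
    have h1 := congrArg (fun ν => ν.real {z}) (R.jumpChainLaw_zero x)
    beta_reduce at h1
    rw [map_measureReal_apply (by fun_prop) (measurableSet_singleton z)] at h1
    rw [avoidProb]
    convert h1 using 2
    · ext ω; simp
    · simp [measureReal_def, Set.indicator_apply, eq_comm, apply_ite]
  simp [h]

lemma measureReal_avoid_step (x : E) (C : Set E) (k : ℕ) (z y : E) :
    (R.jumpChainLaw x).real {ω | (∀ m ∈ Finset.Icc 1 k, ω m ∉ C) ∧ ω k = z ∧ ω (k + 1) = y} =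
      R.avoidProb x C k z * R.jumpProb z y := by
  have h := R.jumpChainLaw_step x k
    {u | ∀ m (hm : m ∈ Finset.Icc 1 k), u ⟨m, by simp at hm ⊢; exact hm.2⟩ ∉ C} z y
  exact h

lemma measureReal_avoid_next (x : E) (C : Set E) (k : ℕ) (y : E) :
    (R.jumpChainLaw x).real {ω | (∀ m ∈ Finset.Icc 1 k, ω m ∉ C) ∧ ω (k + 1) = y} =
      ∑ z, R.avoidProb x C k z * R.jumpProb z y := by
  rw [measureReal_eq_sum_fiber (R.jumpChainLaw x) (Y := fun ω => ω k) (by fun_prop)]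
  refine Finset.sum_congr rfl fun z _ => ?_
  rw [← measureReal_avoid_step]
  congr 1
  ext ω
  simp only [Set.mem_ofPred_eq]
  tauto

lemma avoidProb_succ_of_mem (x : E) {C : Set E} (k : ℕ) {y : E} (hy : y ∈ C) :
    R.avoidProb x C (k + 1) y = 0 := by
  rw [avoidProb]
  convert measureReal_empty
  ext ω
  simp only [Set.mem_ofPred_eq, Set.mem_empty_iff_false, iff_false, not_and]
  rintro h rfl
  exact h (k + 1) (by simp) hy

lemma avoidProb_succ_of_notMem (x : E) {C : Set E} (k : ℕ) {y : E} (hy : y ∉ C) :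
    R.avoidProb x C (k + 1) y = ∑ z, R.avoidProb x C k z * R.jumpProb z y := by
  rw [← measureReal_avoid_next, avoidProb]
  congr 1
  ext ω
  simp only [Set.mem_ofPred_eq, Finset.mem_Icc]
  constructor
  · rintro ⟨h, h'⟩
    exact ⟨fun m hm => h m ⟨hm.1, by omega⟩, h'⟩
  · rintro ⟨h, h'⟩
    refine ⟨fun m hm => ?_, h'⟩
    rcases Nat.lt_or_ge m (k + 1) with h1 | h1
    · exact h m ⟨hm.1, by omega⟩
    · obtain rfl : m = k + 1 := by omega
      rwa [h']

/-- The transition operator of the jump chain. -/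
def jumpOp (f : E → ℝ) (z : E) : ℝ := ∑ y, R.jumpProb z y * f y

open Classical in
/-- One step of the killed chain: mass moves to `C` or stays alive. -/
lemma sum_avoidProb_jumpOp (x : E) (C : Finset E) (k : ℕ) (f : E → ℝ) :
    ∑ z, R.avoidProb x C k z * R.jumpOp f z =
      ∑ y ∈ C, (∑ z, R.avoidProb x C k z * R.jumpProb z y) * f y +
        ∑ y, R.avoidProb x C (k + 1) y * f y := by
  have h1 : ∑ z, R.avoidProb x C k z * R.jumpOp f z =
      ∑ y, (∑ z, R.avoidProb x C k z * R.jumpProb z y) * f y := by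
    simp only [jumpOp, Finset.mul_sum, Finset.sum_mul]
    rw [Finset.sum_comm]
    exact Finset.sum_congr rfl fun y _ => Finset.sum_congr rfl fun z _ => by ring
  rw [h1, ← Finset.sum_filter_add_sum_filter_not Finset.univ (· ∈ C),
    Finset.filter_univ_mem, ← Finset.sum_filter_add_sum_filter_not
      (f := fun y => R.avoidProb x C (k + 1) y * f y) Finset.univ (· ∈ C), Finset.filter_univ_mem,
    Finset.sum_eq_zero (s := C) (f := fun y => R.avoidProb x C (k + 1) y * f y), zero_add]
  · congr 1
    refine Finset.sum_congr rfl fun y hy => ?_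
    rw [R.avoidProb_succ_of_notMem x k (by simpa using hy)]
  · intro y hy
    rw [R.avoidProb_succ_of_mem x k (by simpa using hy), zero_mul]

/-- The equations for `g` are those of the expected hitting time of `C`: each step lowers the
pairing by the surviving mass, so survival probabilities are summable. -/
lemma tendsto_sum_avoidProb (x : E) (C : Finset E) {g : E → ℝ} (hg : ∀ y ∈ C, g y = 0)
    (hg' : ∀ y ∉ C, R.jumpOp g y = g y - 1) :
    Filter.Tendsto (fun k => ∑ z, R.avoidProb x C k z) Filter.atTop (nhds 0) := by
  -- The pairing is with `jumpOp g`, not `g`: the chain may start in `C`, where `hg'` says nothing.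
  have hstep : ∀ k, ∑ z, R.avoidProb x C k z * R.jumpOp g z =
      ∑ z, R.avoidProb x C (k + 1) z * R.jumpOp g z + ∑ z, R.avoidProb x C (k + 1) z := by
    intro k
    rw [sum_avoidProb_jumpOp, Finset.sum_eq_zero (s := C) fun y hy => by rw [hg y hy, mul_zero],
      zero_add, ← Finset.sum_add_distrib]
    refine Finset.sum_congr rfl fun y _ => ?_
    by_cases hy : y ∈ C
    · rw [R.avoidProb_succ_of_mem x k (by simpa using hy)]; ring
    · rw [hg' y hy]; ring
  have htel : ∀ n, ∑ k ∈ Finset.range n, ∑ z, R.avoidProb x C (k + 1) z =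
      ∑ z, R.avoidProb x C 0 z * R.jumpOp g z - ∑ z, R.avoidProb x C n z * R.jumpOp g z := by
    intro n
    induction n with
    | zero => simp
    | succ n ih => rw [Finset.sum_range_succ, ih, hstep n]; ring
  obtain ⟨M, hM⟩ : ∃ M : ℝ, ∀ z, |R.jumpOp g z| ≤ M :=
    ⟨∑ w, |R.jumpOp g w|, fun z =>
      Finset.single_le_sum (f := fun w => |R.jumpOp g w|) (fun w _ => abs_nonneg _)
        (Finset.mem_univ z)⟩
  have hM0 : 0 ≤ M := (abs_nonneg _).trans (hM x)
  have hbd : ∀ n, |∑ z, R.avoidProb x C n z * R.jumpOp g z| ≤ M := by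
    intro n
    calc |∑ z, R.avoidProb x C n z * R.jumpOp g z|
        ≤ ∑ z, |R.avoidProb x C n z * R.jumpOp g z| := Finset.abs_sum_le_sum_abs _ _
      _ ≤ ∑ z, R.avoidProb x C n z * M := Finset.sum_le_sum fun z _ => by
          rw [abs_mul, abs_of_nonneg (R.avoidProb_nonneg x C n z)]
          exact mul_le_mul_of_nonneg_left (hM z) (R.avoidProb_nonneg x C n z)
      _ = (∑ z, R.avoidProb x C n z) * M := by rw [Finset.sum_mul]
      _ ≤ 1 * M := mul_le_mul_of_nonneg_right (R.sum_avoidProb_le x C n) hM0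
      _ = M := one_mul M
  have hsum : Summable fun k => ∑ z, R.avoidProb x C (k + 1) z := by
    refine summable_of_sum_range_le (c := M + M)
      (fun k => Finset.sum_nonneg fun z _ => R.avoidProb_nonneg x C _ z) fun n => ?_
    rw [htel]
    have h1 := abs_le.1 (hbd 0)
    have h2 := abs_le.1 (hbd n)
    linarith [h1.2, h2.1]
  exact (Filter.tendsto_add_atTop_iff_nat 1).1 hsum.tendsto_atTop_zero

open Classical in
/-- The probability that, from time one on, the jump chain hits `B` before `A`. -/
lemma measureReal_hit_before (x : E) {A B : Finset E} (hAB : Disjoint A B) {g h : E → ℝ}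
    (hg : ∀ y ∈ A ∪ B, g y = 0) (hg' : ∀ y ∉ A ∪ B, R.jumpOp g y = g y - 1)
    (hA : ∀ y ∈ A, h y = 0) (hB : ∀ y ∈ B, h y = 1) (hh : ∀ y ∉ A ∪ B, R.jumpOp h y = h y) :
    (R.jumpChainLaw x).real {ω | ∃ n, ω (n + 1) ∈ B ∧ ∀ m ∈ Finset.Icc 1 n, ω m ∉ A ∪ B} =
      R.jumpOp h x := by
  set C := A ∪ B with hC
  -- `b k` is the probability that the first visit to `C` after time zero occurs at time `k + 1` and
  -- in `B`.
  let b : ℕ → ℝ := fun k => ∑ y ∈ B, ∑ z, R.avoidProb x C k z * R.jumpProb z y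
  let D : ℕ → Set (ℕ → E) := fun n => {ω | ω (n + 1) ∈ B ∧ ∀ m ∈ Finset.Icc 1 n, ω m ∉ C}
  have hDm : ∀ n, MeasurableSet (D n) := by
    intro n
    have : D n = {ω | ω (n + 1) ∈ B} ∩ ⋂ m ∈ Finset.Icc 1 n, {ω | ω m ∉ C} := by
      ext ω; simp [D]
    rw [this]
    refine MeasurableSet.inter ?_ (Finset.measurableSet_biInter _ fun m _ => ?_)
    · exact (measurable_pi_apply (n + 1)) (MeasurableSet.of_discrete (s := {y | y ∈ B}))
    · exact measurable_pi_apply (X := fun _ => E) m (MeasurableSet.of_discrete (s := {y | y ∉ C}))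
  have hDb : ∀ n, (R.jumpChainLaw x).real (D n) = b n := by
    intro n
    rw [measureReal_eq_sum_fiber (R.jumpChainLaw x) (Y := fun ω => ω (n + 1)) (by fun_prop),
      ← Finset.sum_filter_add_sum_filter_not Finset.univ (· ∈ B), Finset.filter_univ_mem,
      Finset.sum_eq_zero (s := {y | ¬ y ∈ B}), add_zero]
    · refine Finset.sum_congr rfl fun y hy => ?_
      rw [← measureReal_avoid_next]
      congr 1
      ext ω
      simp only [D, Set.mem_ofPred_eq, Finset.mem_coe]
      constructor
      · rintro ⟨⟨-, h⟩, h'⟩; exact ⟨h, h'⟩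
      · rintro ⟨h, h'⟩; exact ⟨⟨h' ▸ hy, h⟩, h'⟩
    · intro y hy
      convert measureReal_empty
      ext ω
      simp only [D, Set.mem_ofPred_eq, Set.mem_empty_iff_false, iff_false]
      rintro ⟨⟨h, -⟩, rfl⟩
      simp [h] at hy
  have hDd : Pairwise (Function.onFun Disjoint D) := by
    have key : ∀ m n, m < n → Disjoint (D m) (D n) := by
      intro m n hmn
      rw [Set.disjoint_left]
      rintro ω ⟨h1, -⟩ ⟨-, h2⟩
      exact h2 (m + 1) (Finset.mem_Icc.2 ⟨by omega, by omega⟩)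
        (Finset.mem_union_right A h1)
    intro m n hmn
    rcases lt_or_gt_of_ne hmn with h | h
    · exact key m n h
    · exact (key n m h).symm
  have hU : {ω : ℕ → E | ∃ n, ω (n + 1) ∈ B ∧ ∀ m ∈ Finset.Icc 1 n, ω m ∉ C} = ⋃ n, D n := by
    ext ω; simp [D]
  have hsum : HasSum b ((R.jumpChainLaw x).real (⋃ n, D n)) := by
    have h1 := measure_iUnion (μ := R.jumpChainLaw x) hDd hDm
    have h2 : ∑' n, R.jumpChainLaw x (D n) ≠ ⊤ := by rw [← h1]; exact measure_ne_top _ _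
    have h3 := ENNReal.hasSum_toReal h2
    have h4 : (R.jumpChainLaw x).real (⋃ n, D n) = ∑' n, (R.jumpChainLaw x (D n)).toReal := by
      rw [measureReal_def, h1, ENNReal.tsum_toReal_eq fun n => measure_ne_top _ _]
    rw [h4]
    convert h3 using 1
    funext n
    exact (hDb n).symm
  have hstep : ∀ k, ∑ z, R.avoidProb x C k z * R.jumpOp h z =
      b k + ∑ z, R.avoidProb x C (k + 1) z * R.jumpOp h z := by
    intro k
    rw [sum_avoidProb_jumpOp, hC, Finset.sum_union hAB,
      Finset.sum_eq_zero (s := A) fun y hy => by rw [hA y hy, mul_zero], zero_add]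
    congr 1
    · exact Finset.sum_congr rfl fun y hy => by rw [hB y hy, mul_one]
    · refine Finset.sum_congr rfl fun y _ => ?_
      by_cases hy : y ∈ C
      · rw [R.avoidProb_succ_of_mem x k (by simpa [hC] using hy)]; ring
      · rw [hh y hy]
  have htel : ∀ n, ∑ k ∈ Finset.range n, b k =
      R.jumpOp h x - ∑ z, R.avoidProb x C n z * R.jumpOp h z := by
    intro n
    induction n with
    | zero => rw [Finset.sum_range_zero, R.avoidProb_zero, sub_self]
    | succ n ih => rw [Finset.sum_range_succ, ih, hstep n]; ring
  have hz : ∀ z, Filter.Tendsto (fun n => R.avoidProb x C n z) Filter.atTop (nhds 0) := fun z =>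
    squeeze_zero (fun n => R.avoidProb_nonneg x C n z)
      (fun n => Finset.single_le_sum (f := fun z => R.avoidProb x C n z)
        (fun w _ => R.avoidProb_nonneg x C n w) (Finset.mem_univ z))
      (R.tendsto_sum_avoidProb x C hg hg')
  have hlim : Filter.Tendsto (fun n => ∑ z, R.avoidProb x C n z * R.jumpOp h z)
      Filter.atTop (nhds 0) := by
    have := tendsto_finsetSum (Finset.univ : Finset E) fun z _ =>
      (hz z).mul_const (R.jumpOp h z)
    simpa using this
  have hlim2 : Filter.Tendsto (fun n => ∑ k ∈ Finset.range n, b k) Filter.atTop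
      (nhds (R.jumpOp h x)) := by
    simp only [htel]
    simpa using hlim.const_sub (R.jumpOp h x)
  rw [hU]
  exact tendsto_nhds_unique hsum.tendsto_sum_nat hlim2

end JumpChain

end JumpRates

namespace JumpRates

/-! ### Return times along a path -/

section Paths

variable {E : Type*} [Fintype E] {R : JumpRates E} {ω : (ℕ → E) × (ℕ → ℝ)}

lemma jumpTime_zero : R.jumpTime 0 ω = 0 := by simp [jumpTime]

lemma jumpTime_ne_top (hl : ∀ x, 0 < R.holdRate x) (n : ℕ) : R.jumpTime n ω ≠ ⊤ := by
  refine ENNReal.sum_ne_top.2 fun i _ => ?_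
  exact ENNReal.div_ne_top ENNReal.ofReal_ne_top (ENNReal.ofReal_pos.2 (hl _)).ne'

lemma jumpTime_lt_succ (hl : ∀ x, 0 < R.holdRate x) (hT : ∀ i, 0 < ω.2 i) (n : ℕ) :
    R.jumpTime n ω < R.jumpTime (n + 1) ω := by
  have h : R.jumpTime (n + 1) ω = R.jumpTime n ω +
      ENNReal.ofReal (ω.2 n) / ENNReal.ofReal (R.holdRate (ω.1 n)) :=
    Finset.sum_range_succ _ _
  rw [h]
  exact ENNReal.lt_add_right (jumpTime_ne_top hl n)
    (ENNReal.div_pos (ENNReal.ofReal_pos.2 (hT n)).ne' ENNReal.ofReal_ne_top).ne'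

lemma strictMono_jumpTime (hl : ∀ x, 0 < R.holdRate x) (hT : ∀ i, 0 < ω.2 i) :
    StrictMono fun n => R.jumpTime n ω :=
  strictMono_nat_of_lt_succ (jumpTime_lt_succ hl hT)

lemma process_eq (hl : ∀ x, 0 < R.holdRate x) (hT : ∀ i, 0 < ω.2 i) {n : ℕ} {t : ℝ≥0}
    (h1 : R.jumpTime n ω ≤ t) (h2 : (t : ℝ≥0∞) < R.jumpTime (n + 1) ω) :
    R.process t ω = ω.1 n := by
  classical
  have h : ∃ n, (t : ℝ≥0∞) < R.jumpTime (n + 1) ω := ⟨n, h2⟩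
  rw [process, dif_pos h]
  refine congrArg ω.1 ((Nat.find_eq_iff h).2 ?_)
  refine ⟨h2, fun m hm => not_lt.2 (le_trans ?_ h1)⟩
  exact (strictMono_jumpTime hl hT).monotone (by omega : m + 1 ≤ n)

lemma process_eq_of_lt (hl : ∀ x, 0 < R.holdRate x) (hT : ∀ i, 0 < ω.2 i) {n : ℕ} {t : ℝ≥0}
    (h : (t : ℝ≥0∞) < R.jumpTime (n + 1) ω) :
    ∃ k ≤ n, R.jumpTime k ω ≤ t ∧ (t : ℝ≥0∞) < R.jumpTime (k + 1) ω ∧ R.process t ω = ω.1 k := by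
  induction n with
  | zero =>
    have h0 : R.jumpTime 0 ω ≤ t := by rw [jumpTime_zero]; exact zero_le
    exact ⟨0, le_rfl, h0, h, process_eq hl hT h0 h⟩
  | succ n ih =>
    rcases lt_or_ge (t : ℝ≥0∞) (R.jumpTime (n + 1) ω) with h1 | h1
    · obtain ⟨k, hk, h2⟩ := ih h1
      exact ⟨k, by omega, h2⟩
    · exact ⟨n + 1, le_rfl, h1, h, process_eq hl hT h1 h⟩

lemma process_zero (hl : ∀ x, 0 < R.holdRate x) (hT : ∀ i, 0 < ω.2 i) :
    R.process 0 ω = ω.1 0 := by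
  refine process_eq hl hT (by simp [jumpTime_zero]) ?_
  have := jumpTime_lt_succ hl hT 0
  rwa [jumpTime_zero] at this

/-- Before the jump time `S_{n+1}` there is no return to a set that is not visited by the jump
chain at times `1, …, n`. -/
lemma jumpTime_le_returnTime (hl : ∀ x, 0 < R.holdRate x) (hT : ∀ i, 0 < ω.2 i) {A : Finset E}
    {n : ℕ} (h : ∀ m ∈ Finset.Icc 1 n, ω.1 m ∉ A) :
    R.jumpTime (n + 1) ω ≤ R.returnTime A ω := by
  refine le_sInf ?_
  rintro _ ⟨t, rfl, -, htA, s, -, hst, hs⟩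
  by_contra! hlt
  obtain ⟨k, hk, -, hk2, hp⟩ := process_eq_of_lt hl hT hlt
  -- For `k = 0` the path has not yet left `X_0` at time `t`, against the choice of `s`.
  rcases Nat.eq_zero_or_pos k with rfl | hk0
  · refine hs ?_
    rw [process_zero hl hT]
    refine process_eq hl hT (by simp [jumpTime_zero]) (lt_trans ?_ hk2)
    exact_mod_cast hst
  · exact h k (Finset.mem_Icc.2 ⟨hk0, hk⟩) (hp ▸ htA)

/-- The return to a set occurs at the latest when the jump chain is in that set. -/
lemma returnTime_le_jumpTime (hl : ∀ x, 0 < R.holdRate x) (hT : ∀ i, 0 < ω.2 i) {A : Finset E}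
    (h01 : ω.1 1 ≠ ω.1 0) {n : ℕ} (hn : 1 ≤ n) (h : ω.1 n ∈ A) :
    R.returnTime A ω ≤ R.jumpTime n ω := by
  have hS := strictMono_jumpTime hl hT
  refine le_of_forall_gt_imp_ge_of_dense fun c hc => ?_
  -- The witness `s` is the first jump time, so `t'` must lie strictly after `S_n` to cover `n = 1`.
  obtain ⟨t', ht1, ht2⟩ := exists_between (lt_min hc (jumpTime_lt_succ hl hT n))
  obtain ⟨ht2, ht3⟩ := lt_min_iff.1 ht2
  lift t' to ℝ≥0 using (ht3.trans_le le_top).ne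
  refine le_trans (sInf_le ⟨t', rfl, ?_, ?_, (R.jumpTime 1 ω).toNNReal, ?_, ?_, ?_⟩) ht2.le
  · exact_mod_cast zero_le.trans_lt ht1
  · rwa [process_eq hl hT ht1.le ht3]
  · refine ENNReal.toNNReal_pos ?_ (jumpTime_ne_top hl 1)
    have := jumpTime_lt_succ hl hT 0
    rw [jumpTime_zero] at this
    exact this.ne'
  · rw [← ENNReal.coe_lt_coe, ENNReal.coe_toNNReal (jumpTime_ne_top hl 1)]
    exact (hS.monotone hn).trans_lt ht1
  · have h1 : ((R.jumpTime 1 ω).toNNReal : ℝ≥0∞) = R.jumpTime 1 ω :=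
      ENNReal.coe_toNNReal (jumpTime_ne_top hl 1)
    rw [process_zero hl hT, process_eq hl hT (n := 1) h1.ge (by
      rw [h1]; exact jumpTime_lt_succ hl hT 1)]
    exact h01

/-- In terms of the jump chain, `T⁺_A > T⁺_B` means that `B` is hit before `A`. -/
lemma returnTime_lt_iff [DecidableEq E] (hl : ∀ x, 0 < R.holdRate x) (hT : ∀ i, 0 < ω.2 i)
    {A B : Finset E} (hAB : Disjoint A B) (h0 : ω.1 0 ∈ A) (h01 : ω.1 1 ≠ ω.1 0) :
    R.returnTime A ω > R.returnTime B ω ↔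
      ∃ n, ω.1 (n + 1) ∈ B ∧ ∀ m ∈ Finset.Icc 1 n, ω.1 m ∉ A ∪ B := by
  constructor
  · intro h
    obtain ⟨-, ⟨t, rfl, -, htB, -⟩, -⟩ := sInf_lt_iff.1 h
    have h0B : ω.1 0 ∉ B := Finset.disjoint_left.1 hAB h0
    have hex : ∃ k, ω.1 (k + 1) ∈ A ∪ B := by
      by_cases hx : ∃ n, (t : ℝ≥0∞) < R.jumpTime (n + 1) ω
      · obtain ⟨n, hn⟩ := hx
        obtain ⟨k, -, -, -, hp⟩ := process_eq_of_lt hl hT hn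
        rw [hp] at htB
        cases k with
        | zero => exact absurd htB h0B
        | succ k => exact ⟨k, Finset.mem_union_right A htB⟩
      -- If the jump times accumulate, the default value `Y_0` lies in `A`, hence not in `B`;
      -- explosion need not be excluded.
      · rw [process, dif_neg hx] at htB
        exact absurd htB h0B
    have hmin : ∀ m ∈ Finset.Icc 1 (Nat.find hex), ω.1 m ∉ A ∪ B := by
      intro m hm
      obtain ⟨h1, h2⟩ := Finset.mem_Icc.1 hm
      have := Nat.find_min hex (m := m - 1) (by omega)
      rwa [Nat.sub_add_cancel h1] at this
    refine ⟨Nat.find hex, ?_, hmin⟩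
    rcases Finset.mem_union.1 (Nat.find_spec hex) with hA | hB
    · have h1 := returnTime_le_jumpTime hl hT h01 (by omega) hA
      have h2 := jumpTime_le_returnTime (A := B) hl hT fun m hm hmB =>
        hmin m hm (Finset.mem_union_right A hmB)
      exact absurd (h1.trans h2) (not_le.2 h)
    · exact hB
  · rintro ⟨n, hn, hmin⟩
    refine lt_of_le_of_lt (returnTime_le_jumpTime hl hT h01 (by omega) hn)
      (lt_of_lt_of_le (jumpTime_lt_succ hl hT (n + 1)) (jumpTime_le_returnTime hl hT ?_))
    intro m hm hmA
    obtain ⟨h1, h2⟩ := Finset.mem_Icc.1 hm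
    rcases Nat.lt_or_ge n m with h3 | h3
    · obtain rfl : m = n + 1 := by omega
      exact Finset.disjoint_left.1 hAB hmA hn
    · exact hmin m (Finset.mem_Icc.2 ⟨h1, h3⟩) (Finset.mem_union_left B hmA)

end Paths

/-! ### Reduction of the return event to the jump chain -/

section PathLaw

lemma ae_expMeasure_pos : ∀ᵐ t ∂(expMeasure 1), 0 < t := by
  have := isProbabilityMeasure_expMeasure one_pos
  have h := cdf_expMeasure_eq one_pos 0
  have h1 := ofReal_cdf (expMeasure 1) 0
  rw [h] at h1
  simp only [le_refl, if_true, mul_zero, neg_zero, Real.exp_zero, sub_self,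
    ENNReal.ofReal_zero] at h1
  rw [ae_iff]
  convert h1.symm using 2
  ext t
  simp

variable {E : Type*} [Fintype E] [MeasurableSpace E] [DiscreteMeasurableSpace E]
  {R : JumpRates E}

lemma ae_pathLaw_pos (x : E) : ∀ᵐ ω ∂(R.pathLaw x), ∀ i, 0 < ω.2 i := by
  have := isProbabilityMeasure_expMeasure one_pos
  have h : ∀ᵐ T ∂(Measure.infinitePi fun _ : ℕ => expMeasure 1), ∀ i, 0 < T i :=
    ae_all_iff.2 fun i => (measurePreserving_eval_infinitePi
      (fun _ : ℕ => expMeasure 1) i).quasiMeasurePreserving.ae ae_expMeasure_pos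
  exact Measure.quasiMeasurePreserving_snd.ae h

lemma ae_jumpChainLaw_start (hl : ∀ x, 0 < R.holdRate x) (x : E) :
    ∀ᵐ Y ∂(R.jumpChainLaw x), Y 0 = x ∧ Y 1 ≠ Y 0 := by
  have h0 : ∀ᵐ Y ∂(R.jumpChainLaw x), Y 0 = x := by
    have h1 : ∀ᵐ y ∂((R.jumpChainLaw x).map fun Y => Y 0), y = x := by
      rw [R.jumpChainLaw_zero]
      exact (ae_dirac_iff (measurableSet_singleton x)).2 rfl
    exact ae_of_ae_map (measurable_pi_apply 0).aemeasurable h1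
  have h1 : ∀ z : E, ∀ᵐ Y ∂(R.jumpChainLaw x), ¬ (Y 0 = z ∧ Y 1 = z) := by
    intro z
    have h2 := R.measureReal_avoid_step x ∅ 0 z z
    -- A positive holding rate rules out the absorbing case, so the first step really moves.
    have h3 : R.jumpProb z z = 0 := by
      rw [jumpProb, if_neg (hl z).ne', R.rate_self, zero_div]
    rw [h3, mul_zero, measureReal_eq_zero_iff] at h2
    rw [ae_iff]
    convert h2 using 2
    ext Y
    simp
  filter_upwards [h0, ae_all_iff.2 h1] with Y hY hY'
  exact ⟨hY, fun h => hY' (Y 0) ⟨rfl, h⟩⟩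

open Classical in
lemma measureReal_returnTime_lt (hl : ∀ x, 0 < R.holdRate x) {A B : Finset E}
    (hAB : Disjoint A B) {x : E} (hx : x ∈ A) :
    (R.pathLaw x).real {ω | R.returnTime A ω > R.returnTime B ω} =
      (R.jumpChainLaw x).real
        {Y | ∃ n, Y (n + 1) ∈ B ∧ ∀ m ∈ Finset.Icc 1 n, Y m ∉ A ∪ B} := by
  have := isProbabilityMeasure_expMeasure one_pos
  set S : Set (ℕ → E) := {Y | ∃ n, Y (n + 1) ∈ B ∧ ∀ m ∈ Finset.Icc 1 n, Y m ∉ A ∪ B}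
  have h1 : {ω | R.returnTime A ω > R.returnTime B ω} =ᵐ[R.pathLaw x]
      (S ×ˢ Set.univ : Set ((ℕ → E) × (ℕ → ℝ))) := by
    filter_upwards [ae_pathLaw_pos (R := R) x,
      Measure.quasiMeasurePreserving_fst.ae (ae_jumpChainLaw_start hl x)] with ω hT h
    refine propext ?_
    have := returnTime_lt_iff hl hT hAB (by rw [h.1]; exact hx) h.2
    refine this.trans ?_
    exact ⟨fun h => ⟨h, Set.mem_univ _⟩, fun h => h.1⟩
  rw [measureReal_def, measure_congr h1, pathLaw, Measure.prod_prod, measure_univ, mul_one]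
  rfl

end PathLaw

end JumpRates

/-! ### Flows, gradients and divergences -/

namespace JumpRates

section FlowCalculus

variable {E : Type*} {R : JumpRates E} {μ : E → ℝ}

/-- The gradient flow `(x,y) ↦ c_s(x,y) [f(x) - f(y)]`. -/
def gradFlow (R : JumpRates E) (μ : E → ℝ) (f : E → ℝ) (x y : E) : ℝ :=
  R.condSymm μ x y * (f x - f y)

lemma condSymm_nonneg (hpos : ∀ x, 0 < μ x) (x y : E) : 0 ≤ R.condSymm μ x y := by
  rw [condSymm_eq hpos]
  have h1 := cond_nonneg (R := R) (fun z => (hpos z).le) x y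
  have h2 := cond_nonneg (R := R) (fun z => (hpos z).le) y x
  linarith

lemma condSymm_comm (hpos : ∀ x, 0 < μ x) (x y : E) :
    R.condSymm μ x y = R.condSymm μ y x := by
  rw [condSymm_eq hpos, condSymm_eq hpos, add_comm]

lemma condSymm_eq_zero (hpos : ∀ x, 0 < μ x) {x y : E} (h : ¬ 0 < R.condSymm μ x y) :
    R.condSymm μ x y = 0 :=
  le_antisymm (not_lt.1 h) (condSymm_nonneg hpos x y)

lemma isFlow_gradFlow (hpos : ∀ x, 0 < μ x) (f : E → ℝ) : R.IsFlow μ (R.gradFlow μ f) := by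
  refine ⟨fun x y => ?_, fun x y h => ?_⟩
  · rw [gradFlow, gradFlow, condSymm_comm hpos y x]
    ring
  · rw [gradFlow, condSymm_eq_zero hpos h, zero_mul]

lemma isFlow_flowOf (hpos : ∀ x, 0 < μ x) (f : E → ℝ) : R.IsFlow μ (R.flowOf μ f) := by
  refine ⟨fun x y => ?_, fun x y h => ?_⟩
  · rw [flowOf, flowOf]
    ring
  · have h0 := condSymm_eq_zero hpos h
    rw [condSymm_eq hpos] at h0
    have h1 := cond_nonneg (R := R) (fun z => (hpos z).le) x y
    have h2 := cond_nonneg (R := R) (fun z => (hpos z).le) y x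
    rw [flowOf, show R.cond μ x y = 0 by linarith, show R.cond μ y x = 0 by linarith]
    ring

lemma IsFlow.sub {φ ψ : E → E → ℝ} (hφ : R.IsFlow μ φ) (hψ : R.IsFlow μ ψ) :
    R.IsFlow μ (φ - ψ) := by
  refine ⟨fun x y => ?_, fun x y h => ?_⟩
  · simp only [Pi.sub_apply, hφ.1 x y, hψ.1 x y]
    ring
  · simp only [Pi.sub_apply, hφ.2 x y h, hψ.2 x y h, sub_zero]

variable [Fintype E]

lemma divergence_sub (φ ψ : E → E → ℝ) (x : E) :
    R.divergence μ (φ - ψ) x = R.divergence μ φ x - R.divergence μ ψ x :=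
  Finset.sum_sub_distrib _ _

lemma IsFlow.divergence_eq {φ : E → E → ℝ} (hφ : R.IsFlow μ φ) (x : E) :
    R.divergence μ φ x = ∑ y, φ x y := by
  classical
  refine Finset.sum_filter_of_ne fun y _ hy => ?_
  by_contra h
  exact hy (hφ.2 x y h)

/-- Off the arcs `c_s = 0`, and the convention `1 / 0 = 0` removes the term. -/
lemma flowInner_eq_sum (hpos : ∀ x, 0 < μ x) (φ ψ : E → E → ℝ) :
    R.flowInner μ φ ψ = (1 / 2) * ∑ x, ∑ y, 1 / R.condSymm μ x y * φ x y * ψ x y := by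
  classical
  rw [flowInner, ← Fintype.sum_prod_type']
  congr 1
  refine Finset.sum_filter_of_ne fun e _ he => ?_
  by_contra h
  rw [condSymm_eq_zero hpos h] at he
  simp at he

lemma flowInner_self_nonneg (hpos : ∀ x, 0 < μ x) (φ : E → E → ℝ) : 0 ≤ R.flowInner μ φ φ := by
  rw [flowInner_eq_sum hpos]
  refine mul_nonneg (by norm_num) (Finset.sum_nonneg fun x _ => Finset.sum_nonneg fun y _ => ?_)
  rw [mul_assoc]
  exact mul_nonneg (one_div_nonneg.2 (condSymm_nonneg hpos x y)) (mul_self_nonneg _)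

lemma flowInner_sub_self (hpos : ∀ x, 0 < μ x) (φ ψ : E → E → ℝ) :
    R.flowInner μ (φ - ψ) (φ - ψ) =
      R.flowInner μ φ φ - 2 * R.flowInner μ φ ψ + R.flowInner μ ψ ψ := by
  simp only [flowInner_eq_sum hpos, Finset.mul_sum]
  rw [← Finset.sum_sub_distrib, ← Finset.sum_add_distrib]
  refine Finset.sum_congr rfl fun x _ => ?_
  rw [← Finset.sum_sub_distrib, ← Finset.sum_add_distrib]
  refine Finset.sum_congr rfl fun y _ => ?_
  simp only [Pi.sub_apply]
  ring

lemma flowNorm_sq (hpos : ∀ x, 0 < μ x) (φ : E → E → ℝ) :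
    R.flowNorm μ φ ^ 2 = R.flowInner μ φ φ :=
  Real.sq_sqrt (flowInner_self_nonneg hpos φ)

/-- Summation by parts for flows. -/
lemma flowInner_gradFlow (hpos : ∀ x, 0 < μ x) {φ : E → E → ℝ} (hφ : R.IsFlow μ φ)
    (f : E → ℝ) : R.flowInner μ φ (R.gradFlow μ f) = ∑ x, f x * R.divergence μ φ x := by
  have h1 : ∀ x y, 1 / R.condSymm μ x y * φ x y * R.gradFlow μ f x y =
      f x * φ x y + f y * φ y x := by
    intro x y
    by_cases h : 0 < R.condSymm μ x y
    · rw [gradFlow, hφ.1 x y]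
      field_simp
      ring
    · rw [hφ.1 x y, hφ.2 x y h]
      ring
  have h2 : ∑ x, ∑ y, f y * φ y x = ∑ x, ∑ y, f x * φ x y := Finset.sum_comm
  rw [flowInner_eq_sum hpos]
  simp only [h1, Finset.sum_add_distrib, h2, hφ.divergence_eq, Finset.mul_sum]
  ring

/-- Balance replaces the outgoing conductance multiplying `f x` by the incoming one, which produces
`L*`. -/
lemma divergence_flowOf (hpos : ∀ x, 0 < μ x) (hμ : R.IsStationary μ) (f : E → ℝ) (x : E) :
    R.divergence μ (R.flowOf μ f) x = -condLaplacian (fun x y => R.cond μ y x) f x := by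
  rw [(isFlow_flowOf hpos f).divergence_eq]
  simp only [flowOf, condLaplacian, mul_sub, Finset.sum_sub_distrib]
  rw [← Finset.mul_sum, ← Finset.sum_mul, hμ.sum_cond, neg_sub, mul_comm (f x)]
  simp only [mul_comm]

lemma divergence_gradFlow (hpos : ∀ x, 0 < μ x) (f : E → ℝ) (x : E) :
    R.divergence μ (R.gradFlow μ f) x =
      -(1 / 2) * (condLaplacian (R.cond μ) f x +
        condLaplacian (fun x y => R.cond μ y x) f x) := by
  rw [(isFlow_gradFlow hpos f).divergence_eq, condLaplacian, condLaplacian,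
    ← Finset.sum_add_distrib, Finset.mul_sum]
  refine Finset.sum_congr rfl fun y _ => ?_
  rw [gradFlow, condSymm_eq hpos]
  ring

end FlowCalculus

/-! ### Equilibrium potentials and the variational bound -/

section Potential

variable {E : Type*} [Fintype E] {R : JumpRates E} {μ : E → ℝ}

/-- `V` is the equilibrium potential between `A` and `B` for the conductances `c`. -/
structure IsPotential (c : E → E → ℝ) (A B : Finset E) (V : E → ℝ) : Prop where
  eq_one : ∀ x ∈ A, V x = 1
  eq_zero : ∀ x ∈ B, V x = 0
  harmonic : ∀ x, x ∉ A → x ∉ B → condLaplacian c V x = 0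

lemma exists_isPotential {c : E → E → ℝ} (hc : ∀ x y, 0 ≤ c x y)
    (hbal : ∀ x, ∑ y, c x y = ∑ y, c y x)
    (hirr : ∀ x y, Relation.ReflTransGen (fun u v => 0 < c u v) x y)
    {A B : Finset E} (hA : A.Nonempty) (hAB : Disjoint A B) : ∃ V, IsPotential c A B V := by
  classical
  obtain ⟨V, h1, h2⟩ := exists_dirichlet_solution hc hbal hirr (S := {x | x ∈ A ∪ B})
    (hA.imp fun x hx => Finset.mem_union_left B hx) fun x => if x ∈ A then 1 else 0
  refine ⟨V, fun x hx => ?_, fun x hx => ?_, fun x hxA hxB => ?_⟩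
  · rw [h1 x (Finset.mem_union_left B hx), if_pos hx]
  · rw [h1 x (Finset.mem_union_right A hx), if_neg (Finset.disjoint_right.1 hAB hx)]
  · rw [h2 x (by simp [hxA, hxB]), if_neg hxA]

/-- Pairing with a function that is `1` on `A` and `0` on `B`. -/
lemma sum_mul_eq_sum_of_boundary {A B : Finset E} {f u : E → ℝ} (hfA : ∀ x ∈ A, f x = 1)
    (hfB : ∀ x ∈ B, f x = 0) (hu : ∀ x, x ∉ A → x ∉ B → u x = 0) :
    ∑ x, f x * u x = ∑ x ∈ A, u x := by
  rw [← Finset.sum_subset (Finset.subset_univ A)]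
  · exact Finset.sum_congr rfl fun x hx => by rw [hfA x hx, one_mul]
  · intro x _ hxA
    by_cases hxB : x ∈ B
    · rw [hfB x hxB, zero_mul]
    · rw [hu x hxA hxB, mul_zero]

lemma sum_condLaplacian {c : E → E → ℝ} (hbal : ∀ x, ∑ y, c x y = ∑ y, c y x) (f : E → ℝ) :
    ∑ x, condLaplacian c f x = 0 := by
  have h := condLaplacian_adjoint hbal f fun _ => 1
  simpa [condLaplacian] using h

/-- By adjointness `L` and `L*` contribute equally to the quadratic form, and the boundary values of
`V` leave only `A`. -/
lemma flowInner_gradFlow_self (hpos : ∀ x, 0 < μ x) (hμ : R.IsStationary μ) {A B : Finset E}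
    {V : E → ℝ} (hV : IsPotential (R.cond μ) A B V) :
    R.flowInner μ (R.gradFlow μ V) (R.gradFlow μ V) =
      -∑ x ∈ A, condLaplacian (R.cond μ) V x := by
  rw [flowInner_gradFlow hpos (isFlow_gradFlow hpos V),
    ← sum_mul_eq_sum_of_boundary hV.eq_one hV.eq_zero hV.harmonic]
  have h1 : ∀ x, V x * R.divergence μ (R.gradFlow μ V) x =
      -(1 / 2) * (V x * condLaplacian (R.cond μ) V x +
        V x * condLaplacian (fun x y => R.cond μ y x) V x) := by
    intro x
    rw [divergence_gradFlow hpos]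
    ring
  simp only [h1]
  rw [← Finset.mul_sum, Finset.sum_add_distrib, ← condLaplacian_adjoint hμ.sum_cond V V]
  ring

/-- The capacity bounds the norm of every test flow from below. -/
lemma le_flowInner_sub (hpos : ∀ x, 0 < μ x) (hμ : R.IsStationary μ) {A B : Finset E}
    {V f : E → ℝ} (hV : IsPotential (R.cond μ) A B V)
    (hfA : ∀ x ∈ A, f x = 1) (hfB : ∀ x ∈ B, f x = 0) {φ : E → E → ℝ}
    (hφ : R.IsAdmissibleFlow μ A B φ) :
    -∑ x ∈ A, condLaplacian (R.cond μ) V x ≤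
      R.flowInner μ (R.flowOf μ f - φ) (R.flowOf μ f - φ) := by
  -- `φ` contributes only its total divergence on `A`, which is zero; adjointness moves the operator
  -- from `f` to `V`.
  have h1 : R.flowInner μ (R.flowOf μ f - φ) (R.gradFlow μ V) =
      -∑ x ∈ A, condLaplacian (R.cond μ) V x := by
    rw [flowInner_gradFlow hpos ((isFlow_flowOf hpos f).sub hφ.1)]
    simp only [divergence_sub, divergence_flowOf hpos hμ, mul_sub, mul_neg,
      Finset.sum_sub_distrib, Finset.sum_neg_distrib]
    rw [← condLaplacian_adjoint hμ.sum_cond V f,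
      sum_mul_eq_sum_of_boundary hV.eq_one hV.eq_zero hφ.2.1, hφ.2.2.1, sub_zero,
      sum_mul_eq_sum_of_boundary hfA hfB hV.harmonic]
  have h2 := flowInner_gradFlow_self hpos hμ hV
  have h3 := flowInner_self_nonneg hpos (R.flowOf μ f - φ - R.gradFlow μ V) (R := R)
  rw [flowInner_sub_self hpos, h1, h2] at h3
  linarith

/-- The infimum is attained at the half-sum of the equilibrium potentials of the chain and of its
adjoint. -/
lemma isAdmissibleFlow_optimal (hpos : ∀ x, 0 < μ x) (hμ : R.IsStationary μ) {A B : Finset E}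
    (hAB : Disjoint A B) {V W : E → ℝ} (hV : IsPotential (R.cond μ) A B V)
    (hW : IsPotential (fun x y => R.cond μ y x) A B W) :
    R.IsAdmissibleFlow μ A B
      (R.flowOf μ (fun x => (1 / 2) * (V x + W x)) - R.gradFlow μ V) := by
  classical
  -- The weight `1/2` makes the two `L* V` terms cancel, leaving functions supported on `A ∪ B`.
  have hdiv : ∀ x, R.divergence μ
      (R.flowOf μ (fun x => (1 / 2) * (V x + W x)) - R.gradFlow μ V) x =
      (1 / 2) * (condLaplacian (R.cond μ) V x -
        condLaplacian (fun x y => R.cond μ y x) W x) := by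
    intro x
    have hlin : condLaplacian (fun x y => R.cond μ y x) (fun x => (1 / 2) * (V x + W x)) x =
        (1 / 2) * (condLaplacian (fun x y => R.cond μ y x) V x +
          condLaplacian (fun x y => R.cond μ y x) W x) := by
      simp only [condLaplacian]
      rw [← Finset.sum_add_distrib, Finset.mul_sum]
      exact Finset.sum_congr rfl fun y _ => by ring
    rw [divergence_sub, divergence_flowOf hpos hμ, divergence_gradFlow hpos, hlin]
    ring
  -- Both sides are `∑ W (L V) = ∑ V (L* W)`: the chain and its adjoint have the same charge on `A`.
  have hAsum : ∑ x ∈ A, condLaplacian (R.cond μ) V x =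
      ∑ x ∈ A, condLaplacian (fun x y => R.cond μ y x) W x := by
    rw [← sum_mul_eq_sum_of_boundary hW.eq_one hW.eq_zero hV.harmonic,
      ← sum_mul_eq_sum_of_boundary hV.eq_one hV.eq_zero hW.harmonic,
      condLaplacian_adjoint hμ.sum_cond]
  have hbal' : ∀ x, ∑ y, R.cond μ y x = ∑ y, R.cond μ x y := fun x => (hμ.sum_cond x).symm
  have hsplit : ∀ u : E → ℝ, (∀ x, x ∉ A → x ∉ B → u x = 0) → ∑ x, u x = 0 →
      ∑ x ∈ B, u x = -∑ x ∈ A, u x := by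
    intro u hu h0
    rw [← Finset.sum_subset (Finset.subset_univ (A ∪ B)), Finset.sum_union hAB] at h0
    · linarith
    · intro x _ hx
      rw [Finset.mem_union, not_or] at hx
      exact hu x hx.1 hx.2
  refine ⟨(isFlow_flowOf hpos _).sub (isFlow_gradFlow hpos V), fun x hxA hxB => ?_, ?_, ?_⟩
  · rw [hdiv, hV.harmonic x hxA hxB, hW.harmonic x hxA hxB]
    ring
  · simp only [hdiv]
    rw [← Finset.mul_sum, Finset.sum_sub_distrib, hAsum]
    ring
  · simp only [hdiv]
    rw [← Finset.mul_sum, Finset.sum_sub_distrib,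
      hsplit _ hV.harmonic (sum_condLaplacian hμ.sum_cond V),
      hsplit _ hW.harmonic (sum_condLaplacian hbal' W), hAsum]
    ring

lemma jumpOp_eq (hl : ∀ x, 0 < R.holdRate x) (hpos : ∀ x, 0 < μ x) (f : E → ℝ) (x : E) :
    R.jumpOp f x = f x + condLaplacian (R.cond μ) f x / (μ x * R.holdRate x) := by
  have h1 := (hl x).ne'
  have h2 := (hpos x).ne'
  rw [condLaplacian_cond, mul_div_mul_left _ _ h2]
  have h3 : R.jumpOp f x = (∑ y, R.rate x y * f y) / R.holdRate x := by
    rw [jumpOp, Finset.sum_div]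
    refine Finset.sum_congr rfl fun y _ => ?_
    rw [jumpProb, if_neg h1]
    ring
  have h4 : R.generator f x = (∑ y, R.rate x y * f y) - R.holdRate x * f x := by
    simp only [generator, holdRate, mul_sub, Finset.sum_sub_distrib, Finset.sum_mul]
  rw [h3, h4]
  field_simp
  ring

end Potential

/-! ### Capacity as a charge -/

section Capacity

variable {E : Type*} [Fintype E] [MeasurableSpace E] [DiscreteMeasurableSpace E]
  {R : JumpRates E} {μ : E → ℝ}

/-- The capacity as the total charge of the equilibrium potential on `A`. -/
lemma capacity_eq (hR : R.IsIrreducible) (hl : ∀ x, 0 < R.holdRate x) (hμ : R.IsStationary μ)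
    {A B : Finset E} (hA : A.Nonempty) (hAB : Disjoint A B) {V : E → ℝ}
    (hV : IsPotential (R.cond μ) A B V) :
    R.capacity μ A B = -∑ x ∈ A, condLaplacian (R.cond μ) V x := by
  classical
  have hpos := hμ.pos hR
  -- Division by `μ λ` turns this source term into the `-1` of the hitting time equation.
  obtain ⟨g, hg1, hg2⟩ := exists_dirichlet_solution (cond_nonneg hμ.1) hμ.sum_cond
    (irreducible_cond hμ hR) (S := {x | x ∈ A ∪ B})
    (hA.imp fun x hx => Finset.mem_union_left B hx)
    fun x => if x ∈ A ∪ B then 0 else -(μ x * R.holdRate x)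
  have hop : ∀ x, R.jumpOp (fun y => 1 - V y) x =
      1 - V x - condLaplacian (R.cond μ) V x / (μ x * R.holdRate x) := by
    intro x
    rw [jumpOp_eq hl hpos]
    have : condLaplacian (R.cond μ) (fun y => 1 - V y) x = -condLaplacian (R.cond μ) V x := by
      rw [condLaplacian, condLaplacian, ← Finset.sum_neg_distrib]
      exact Finset.sum_congr rfl fun y _ => by ring
    rw [this]
    ring
  rw [capacity, ← Finset.sum_neg_distrib]
  refine Finset.sum_congr rfl fun x hx => ?_
  have hM : μ x * R.holdRate x ≠ 0 := (mul_pos (hpos x) (hl x)).ne'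
  rw [measureReal_returnTime_lt hl hAB hx,
    R.measureReal_hit_before x hAB (g := g) (h := fun y => 1 - V y), hop, hV.eq_one x hx, sub_self,
    zero_sub, mul_neg, mul_div_cancel₀ _ hM]
  · intro y hy
    rw [hg1 y hy, if_pos hy]
  · intro y hy
    rw [jumpOp_eq hl hpos, hg2 y hy, if_neg hy, neg_div,
      div_self (mul_pos (hpos y) (hl y)).ne', sub_eq_add_neg]
  · intro y hy
    rw [hV.eq_one y hy, sub_self]
  · intro y hy
    rw [hV.eq_zero y hy, sub_zero]
  · intro y hy
    rw [Finset.mem_union, not_or] at hy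
    rw [hop, hV.harmonic y hy.1 hy.2, zero_div, sub_zero]

end Capacity

end JumpRates

/-- The infima are taken in the complete lattice of extended reals, so that none of them can be a
default value. -/
theorem theorem2p5 {E : Type*} [Fintype E] [MeasurableSpace E] [DiscreteMeasurableSpace E]
    (R : JumpRates E) (hR : R.IsIrreducible) (μ : E → ℝ) (hμ : R.IsStationary μ)
    (A B : Finset E) (hA : A.Nonempty) (hB : B.Nonempty) (hAB : Disjoint A B) :
    ((R.capacity μ A B : ℝ) : EReal) =
      ⨅ (f : E → ℝ) (_ : (∀ x ∈ A, f x = 1) ∧ ∀ x ∈ B, f x = 0),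
        ⨅ (φ : E → E → ℝ) (_ : R.IsAdmissibleFlow μ A B φ),
          ((R.flowNorm μ (R.flowOf μ f - φ) ^ 2 : ℝ) : EReal) := by
  have hpos := hμ.pos hR
  have hl : ∀ x, 0 < R.holdRate x := by
    intro x
    obtain ⟨a, ha⟩ := hA
    obtain ⟨b, hb⟩ := hB
    by_cases hx : x = a
    · exact JumpRates.holdRate_pos hR (y := b)
        (fun h => Finset.disjoint_left.1 hAB ha (hx ▸ h ▸ hb))
    · exact JumpRates.holdRate_pos hR hx
  have hc := JumpRates.cond_nonneg (R := R) hμ.1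
  obtain ⟨V, hV⟩ := JumpRates.exists_isPotential hc hμ.sum_cond
    (JumpRates.irreducible_cond hμ hR) hA hAB
  obtain ⟨W, hW⟩ := JumpRates.exists_isPotential (fun x y => hc y x)
    (fun x => (hμ.sum_cond x).symm) (JumpRates.irreducible_cond_swap hμ hR) hA hAB
  rw [JumpRates.capacity_eq hR hl hμ hA hAB hV]
  refine le_antisymm (le_iInf₂ fun f hf => le_iInf₂ fun φ hφ => ?_) ?_
  · rw [JumpRates.flowNorm_sq hpos]
    exact EReal.coe_le_coe_iff.2 (JumpRates.le_flowInner_sub hpos hμ hV hf.1 hf.2 hφ)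
  · refine iInf₂_le_of_le (fun x => (1 / 2) * (V x + W x)) ⟨fun x hx => ?_, fun x hx => ?_⟩
      (iInf₂_le_of_le _ (JumpRates.isAdmissibleFlow_optimal hpos hμ hAB hV hW) ?_)
    · beta_reduce
      rw [hV.eq_one x hx, hW.eq_one x hx]
      norm_num
    · beta_reduce
      rw [hV.eq_zero x hx, hW.eq_zero x hx]
      norm_num
    -- Here `Φ_f - (Φ_f - Ψ_V) = Ψ_V`, whose squared norm is the capacity.
    · rw [sub_sub_cancel, JumpRates.flowNorm_sq hpos,
        JumpRates.flowInner_gradFlow_self hpos hμ hV]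

end
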